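/- Let $X$ be a real Banach space with topological dual $X^*$, and let $F:X\times X\to\mathbb{R}$ satisfy $F(x,x)=0$ for all $x\in X$. Suppose that $F(x,\cdot)$ is convex and continuous on $X$ for every $x\in X$, and that $F(\cdot,y)$ is concave and continuous on $X$ for every $y\in X$. Define the operators $A^F,\ {}^F\!A: X\rightrightarrows X^*$ by $$A^F(x)=\{x^*\in X^*: F(x,y)-F(x,x)\ge\langle x^*,y-x\rangle\ \ \forall y\in X\},$$ $${}^F\!A(x)=\{x^*\in X^*: F(x,x)-F(y,x)\ge\langle x^*,y-x\rangle\ \ \forall y\in X\}.$$ Then $A^F$ is maximal monotone, and $A^F(x)={}^F\!A(x)$ for every $x\in X$. Here an operator $T:X\rightrightarrows X^*$ is called monotone if $\langle y^*-x^*,y-x\rangle\ge 0$ whenever $x^*\in T(x)$ and $y^*\in T(y)$; a monotone operator is maximal if its graph $\{(x,x^*): x^*\in T(x)\}$ is not properly included in the graph of any other monotone operator $X\rightrightarrows X^*$. -/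

import Mathlib

namespace BifunctionMonotone

variable {X : Type*} [NormedAddCommGroup X] [NormedSpace ℝ X]

/-- The graph of a multifunction from `X` to its topological dual. -/
def graph (T : X → Set (StrongDual ℝ X)) : Set (X × StrongDual ℝ X) :=
  {p | p.2 ∈ T p.1}

/-- Monotone operators: `⟨y* - x*, y - x⟩ ≥ 0` whenever `x* ∈ T x` and `y* ∈ T y`. -/
def IsMonotoneOperator (T : X → Set (StrongDual ℝ X)) : Prop :=
  ∀ x y : X, ∀ xs ∈ T x, ∀ ys ∈ T y, 0 ≤ (ys - xs) (y - x)

/-- A monotone operator is maximal when its graph is not properly included in the graph of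
any other monotone operator. -/
def IsMaximalMonotoneOperator (T : X → Set (StrongDual ℝ X)) : Prop :=
  IsMonotoneOperator T ∧
    ∀ S : X → Set (StrongDual ℝ X), IsMonotoneOperator S → ¬ graph T ⊂ graph S

/-- The operator `A^F` attached to a bifunction `F` defined on the whole space:
`x* ∈ A^F(x)` iff `F(x, y) - F(x, x) ≥ ⟨x*, y - x⟩` for all `y`. -/
def rightOperator (F : X → X → ℝ) (x : X) : Set (StrongDual ℝ X) :=
  {xs | ∀ y : X, xs (y - x) ≤ F x y - F x x}

/-- The operator `^F A` attached to a bifunction `F` defined on the whole space: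
`x* ∈ ^F A(x)` iff `F(x, x) - F(y, x) ≥ ⟨x*, y - x⟩` for all `y`. -/
def leftOperator (F : X → X → ℝ) (x : X) : Set (StrongDual ℝ X) :=
  {xs | ∀ y : X, xs (y - x) ≤ F x x - F y x}

end BifunctionMonotone

namespace BifunctionMonotone

open Filter Topology

/-! Everything is tested at `z = x + t(y - x)` as `t → 0⁺`. Concavity and `F z z = 0` give `A^F ⊆ ^F
A`; the symmetry `(x, y) ↦ -F y x` gives the converse. Adding the two defining inequalities yields
monotonicity. Maximality is Minty's trick: Hahn–Banach makes every `A^F(z)` nonempty, so a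
monotonically related pair can be compared with a subgradient at `z`. -/

/-- A continuous convex real function on a normed space has a subgradient at every point. -/
theorem exists_subgradient {E : Type*} [NormedAddCommGroup E] [NormedSpace ℝ E] {f : E → ℝ}
    (hf : ConvexOn ℝ Set.univ f) (hc : Continuous f) (x : E) :
    ∃ l : StrongDual ℝ E, ∀ y : E, l (y - x) ≤ f y - f x := by
  have hconv : Convex ℝ {p : E × ℝ | f p.1 < p.2} := by
    simpa using hf.convex_strict_epigraph
  have hopen : IsOpen {p : E × ℝ | f p.1 < p.2} :=
    isOpen_lt (hc.comp continuous_fst) continuous_snd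
  obtain ⟨φ, hφ⟩ := geometric_hahn_banach_open_point (x := (x, f x)) hconv hopen (by simp)
  have split : ∀ (y : E) (r : ℝ), φ (y, r) = φ (y, 0) + r * φ (0, 1) := by
    intro y r
    have h : ((y, r) : E × ℝ) = (y, 0) + r • (0, 1) := by simp
    rw [h, map_add, map_smul, smul_eq_mul]
  -- The separating hyperplane is not vertical, so `φ` can be rescaled to vertical coefficient `-1`.
  have hneg : φ (0, 1) < 0 := by
    have h := hφ (x, f x + 1) (by simp)
    rw [split x (f x + 1), split x (f x)] at h
    linarith
  have hle : ∀ y : E, φ (y, f y) ≤ φ (x, f x) := by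
    intro y
    have hlim : Tendsto (fun r : ℝ => φ (y, r)) (𝓝[>] f y) (𝓝 (φ (y, f y))) :=
      ((by fun_prop : Continuous fun r : ℝ => φ (y, r)).tendsto _).mono_left nhdsWithin_le_nhds
    refine le_of_tendsto hlim ?_
    filter_upwards [self_mem_nhdsWithin] with r hr using (hφ (y, r) hr).le
  refine ⟨(-φ (0, 1))⁻¹ • φ.comp (ContinuousLinearMap.inl ℝ E ℝ), fun y => ?_⟩
  have h := hle y
  rw [split y, split x] at h
  have hsub : φ (y - x, 0) = φ (y, 0) - φ (x, 0) := by
    rw [← map_sub]; simp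
  simp only [smul_apply, ContinuousLinearMap.comp_apply,
    ContinuousLinearMap.inl_apply, smul_eq_mul, hsub]
  rw [inv_mul_le_iff₀ (by linarith)]
  linarith

/-- Points of a segment close to its starting point, as a limit along `t → 0⁺`. -/
theorem tendsto_add_smul_nhdsGT_zero {E : Type*} [NormedAddCommGroup E] [NormedSpace ℝ E]
    (x v : E) : Tendsto (fun t : ℝ => x + t • v) (𝓝[>] 0) (𝓝 x) := by
  have h : Continuous fun t : ℝ => x + t • v := by fun_prop
  simpa using (h.tendsto 0).mono_left nhdsWithin_le_nhds

/-- The factor `1 - t` disappears as `t → 0⁺`. -/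
theorem tendsto_one_sub_mul_nhdsGT_zero (a : ℝ) :
    Tendsto (fun t : ℝ => (1 - t) * a) (𝓝[>] 0) (𝓝 a) := by
  have h : Continuous fun t : ℝ => (1 - t) * a := by fun_prop
  simpa using (h.tendsto 0).mono_left nhdsWithin_le_nhds

/-- Concavity gives `0 = F z z ≥ (1 - t) F x z + t F y z`, while `F x z ≥ t ⟨x*, y - x⟩`. Divide by
`t` and let `z → x` in `F y z`. -/
theorem rightOperator_subset_leftOperator {X : Type*} [NormedAddCommGroup X] [NormedSpace ℝ X]
    {F : X → X → ℝ} (hdiag : ∀ x, F x x = 0)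
    (hcont_right : ∀ x, Continuous fun y => F x y)
    (hconcave : ∀ y, ConcaveOn ℝ Set.univ fun x => F x y) (x : X) :
    rightOperator F x ⊆ leftOperator F x := by
  intro xs hxs y
  rw [hdiag, zero_sub, le_neg]
  refine le_of_tendsto_of_tendsto
    (((hcont_right y).tendsto x).comp (tendsto_add_smul_nhdsGT_zero x (y - x)))
    (tendsto_one_sub_mul_nhdsGT_zero (-xs (y - x))) ?_
  filter_upwards [Ioo_mem_nhdsGT (zero_lt_one (α := ℝ))] with t ht
  obtain ⟨ht0, ht1⟩ := ht
  simp only [Function.comp_apply]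
  have hz : (1 - t) • x + t • y = x + t • (y - x) := by module
  have h1 := (hconcave (x + t • (y - x))).2 (Set.mem_univ x) (Set.mem_univ y)
    (sub_nonneg.2 ht1.le) ht0.le (by ring)
  simp only [hz, hdiag, smul_eq_mul] at h1
  have h2 := hxs (x + t • (y - x))
  rw [add_sub_cancel_left, map_smul, smul_eq_mul, hdiag, sub_zero] at h2
  have h3 := mul_le_mul_of_nonneg_left h2 (sub_nonneg.2 ht1.le)
  refine le_of_mul_le_mul_left ?_ ht0
  linarith

/-- Passing to the bifunction `(x, y) ↦ -F y x` exchanges the two operators. -/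
theorem rightOperator_neg_swap {X : Type*} [NormedAddCommGroup X] [NormedSpace ℝ X]
    (F : X → X → ℝ) : rightOperator (fun x y => -F y x) = leftOperator F := by
  ext x xs
  refine forall_congr' fun y => ?_
  rw [neg_sub_neg]

theorem leftOperator_neg_swap {X : Type*} [NormedAddCommGroup X] [NormedSpace ℝ X]
    (F : X → X → ℝ) : leftOperator (fun x y => -F y x) = rightOperator F := by
  ext x xs
  refine forall_congr' fun y => ?_
  rw [neg_sub_neg]

theorem rightOperator_eq_leftOperator {X : Type*} [NormedAddCommGroup X] [NormedSpace ℝ X]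
    {F : X → X → ℝ} (hdiag : ∀ x, F x x = 0)
    (hconvex : ∀ x, ConvexOn ℝ Set.univ fun y => F x y)
    (hcont_right : ∀ x, Continuous fun y => F x y)
    (hconcave : ∀ y, ConcaveOn ℝ Set.univ fun x => F x y)
    (hcont_left : ∀ y, Continuous fun x => F x y) :
    rightOperator F = leftOperator F := by
  funext x
  refine (rightOperator_subset_leftOperator hdiag hcont_right hconcave x).antisymm ?_
  have h := rightOperator_subset_leftOperator (F := fun x y => -F y x)
    (fun z => neg_eq_zero.2 (hdiag z)) (fun z => (hcont_left z).neg) (fun z => (hconvex z).neg) x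
  rwa [rightOperator_neg_swap, leftOperator_neg_swap] at h

theorem isMonotoneOperator_rightOperator {X : Type*} [NormedAddCommGroup X] [NormedSpace ℝ X]
    {F : X → X → ℝ} (hdiag : ∀ x, F x x = 0) (heq : rightOperator F = leftOperator F) :
    IsMonotoneOperator (rightOperator F) := by
  intro x y xs hxs ys hys
  rw [heq] at hys
  have h1 := hxs y
  have h2 := hys x
  rw [hdiag] at h1 h2
  rw [← neg_sub y x, map_neg] at h2
  rw [sub_apply]
  linarith

/-- A dual pair monotonically related to the graph of `A^F` belongs to that graph. -/
theorem mem_rightOperator_of_monotonically_related {X : Type*} [NormedAddCommGroup X]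
    [NormedSpace ℝ X] {F : X → X → ℝ} (hdiag : ∀ x, F x x = 0)
    (hconvex : ∀ x, ConvexOn ℝ Set.univ fun y => F x y)
    (hcont_right : ∀ x, Continuous fun y => F x y)
    (hcont_left : ∀ y, Continuous fun x => F x y) {x : X} {xs : StrongDual ℝ X}
    (hrel : ∀ y, ∀ ys ∈ rightOperator F y, 0 ≤ (ys - xs) (y - x)) :
    xs ∈ rightOperator F x := by
  intro y
  rw [hdiag, sub_zero]
  refine le_of_tendsto_of_tendsto (tendsto_one_sub_mul_nhdsGT_zero (xs (y - x)))
    (((hcont_left y).tendsto x).comp (tendsto_add_smul_nhdsGT_zero x (y - x))) ?_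
  filter_upwards [Ioo_mem_nhdsGT (zero_lt_one (α := ℝ))] with t ht
  obtain ⟨ht0, ht1⟩ := ht
  simp only [Function.comp_apply]
  obtain ⟨zs, hzs⟩ := exists_subgradient (hconvex (x + t • (y - x)))
    (hcont_right (x + t • (y - x))) (x + t • (y - x))
  have h1 := hrel _ zs hzs
  rw [add_sub_cancel_left, map_smul, smul_eq_mul, sub_apply] at h1
  -- Since `z - x = t(y - x)`, cancelling `t` leaves `⟨x*, y - x⟩ ≤ ⟨z*, y - x⟩`.
  have h2 := sub_nonneg.1 (nonneg_of_mul_nonneg_right h1 ht0)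
  have h3 := hzs y
  rw [show y - (x + t • (y - x)) = (1 - t) • (y - x) by module, map_smul, smul_eq_mul, hdiag,
    sub_zero] at h3
  exact (mul_le_mul_of_nonneg_left h2 (sub_nonneg.2 ht1.le)).trans h3

end BifunctionMonotone

theorem mainTheorem8 {X : Type*} [NormedAddCommGroup X] [NormedSpace ℝ X] [CompleteSpace X]
    (F : X → X → ℝ)
    (hdiag : ∀ x : X, F x x = 0)
    (hconvex : ∀ x : X, ConvexOn ℝ Set.univ (fun y : X => F x y))
    (hcont_right : ∀ x : X, Continuous (fun y : X => F x y))
    (hconcave : ∀ y : X, ConcaveOn ℝ Set.univ (fun x : X => F x y))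
    (hcont_left : ∀ y : X, Continuous (fun x : X => F x y)) :
    BifunctionMonotone.IsMaximalMonotoneOperator (BifunctionMonotone.rightOperator F) ∧
      BifunctionMonotone.rightOperator F = BifunctionMonotone.leftOperator F := by
  have heq := BifunctionMonotone.rightOperator_eq_leftOperator hdiag hconvex hcont_right
    hconcave hcont_left
  refine ⟨⟨BifunctionMonotone.isMonotoneOperator_rightOperator hdiag heq, ?_⟩, heq⟩
  rintro S hS ⟨hsub, hnot⟩
  refine hnot fun p hp => ?_
  exact BifunctionMonotone.mem_rightOperator_of_monotonically_related hdiag hconvex hcont_right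
    hcont_left fun y ys hys => hS p.1 y p.2 hp ys (hsub (a := (y, ys)) hys)
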